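/- Let $K$ be a field and let $\alpha_1,\alpha_2,\alpha_3,\alpha_4>1$ and $\alpha_{21}>0$ be integers with $\alpha_{21}<\alpha_1-1$. Put $$n_1=\alpha_2\alpha_3(\alpha_4-1)+1,\qquad n_2=\alpha_{21}\alpha_3\alpha_4+(\alpha_1-\alpha_{21}-1)(\alpha_3-1)+\alpha_3,$$ $$n_3=\alpha_1\alpha_4+(\alpha_1-\alpha_{21}-1)(\alpha_2-1)(\alpha_4-1)-\alpha_4+1,\qquad n_4=\alpha_1\alpha_2(\alpha_3-1)+\alpha_{21}(\alpha_2-1)+\alpha_2,$$ and assume $\gcd(n_1,n_2,n_3,n_4)=1$. (By a theorem of Komeda, the semigroups $S=\langle n_1,n_2,n_3,n_4\rangle$ arising in this way are, up to the numbering of the generators, exactly the minimally 4-generated pseudo-symmetric numerical semigroups.) Let $A=K[X_1,X_2,X_3,X_4]$, let $I_S\subset A$ be the kernel of $A\to K[t]$, $X_i\mapsto t^{n_i}$, that is, the ideal of the monomial curve $C_S$, and let $I_{S*}$ be the ideal generated by the lowest-degree homogeneous summands $f_*$ of the elements $f\in I_S$, so that $A/I_{S*}$ is the coordinate ring of the tangent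 cone of $C_S$ at the origin. Put $$f_1=X_1^{\alpha_1}-X_3X_4^{\alpha_4-1},\quad f_2=X_2^{\alpha_2}-X_1^{\alpha_{21}}X_4,\quad f_3=X_3^{\alpha_3}-X_1^{\alpha_1-\alpha_{21}-1}X_2,$$ $$f_4=X_4^{\alpha_4}-X_1X_2^{\alpha_2-1}X_3^{\alpha_3-1},\quad f_5=X_3^{\alpha_3-1}X_1^{\alpha_{21}+1}-X_2X_4^{\alpha_4-1}.$$ Suppose $n_1$ is the smallest of $n_1,n_2,n_3,n_4$. Then the tangent cone of $C_S$ at the origin is Cohen–Macaulay, i.e. $A/I_{S*}$ is a Cohen–Macaulay ring, if and only if $$\alpha_2\le\alpha_{21}+1,\qquad \alpha_{21}+\alpha_3\le\alpha_1,\qquad \alpha_4\le\alpha_2+\alpha_3-1.$$ In that case $f_1,\dots,f_5$ form a minimal standard basis of $I_S$ with respect to every negative degree reverse lexicographic order in which $X_1$ is the smallest variable; that is, their leading monomials generate the ideal of leading monomials of $I_S$, and none of these five leading monomials divides another. -/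

import Mathlib

open MvPolynomial

/-- A (Noetherian) local ring is Cohen–Macaulay if its maximal ideal contains a regular sequence
whose length is the Krull dimension of the ring. -/
def IsCohenMacaulayLocal (R : Type*) [CommRing R] [IsLocalRing R] : Prop :=
  ∃ rs : List R, (∀ r ∈ rs, r ∈ IsLocalRing.maximalIdeal R) ∧
    RingTheory.Sequence.IsRegular R rs ∧ (rs.length : WithBot ℕ∞) = ringKrullDim R

/-- A Noetherian ring is Cohen–Macaulay if all its localizations at maximal ideals are
Cohen–Macaulay local rings. -/
def IsCohenMacaulay (R : Type*) [CommRing R] : Prop :=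
  IsNoetherianRing R ∧
    ∀ (p : Ideal R) [p.IsMaximal], IsCohenMacaulayLocal (Localization.AtPrime p)

/-- The ideal `I_S` of the monomial curve `X_i = t ^ n_i`: the kernel of
`K[X₁, …, X₄] → K[t]`, `X_i ↦ t ^ n_i`. The variable `X_i` of the text is `X (i - 1)`. -/
noncomputable def curveIdeal (K : Type*) [Field K] (n : Fin 4 → ℕ) :
    Ideal (MvPolynomial (Fin 4) K) :=
  RingHom.ker (aeval (fun i => (Polynomial.X : Polynomial K) ^ n i) :
    MvPolynomial (Fin 4) K →ₐ[K] Polynomial K)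

/-- The homogeneous summand `f_*` of least degree of `f` (with `0_* = 0`). -/
noncomputable def initialForm {K : Type*} [Field K] (f : MvPolynomial (Fin 4) K) :
    MvPolynomial (Fin 4) K :=
  homogeneousComponent (sInf {d : ℕ | homogeneousComponent d f ≠ 0}) f

/-- The defining ideal of the tangent cone at the origin of the zero set of `I`: it is generated
by the homogeneous summands of least degree of the elements of `I`. -/
noncomputable def tangentConeIdeal {K : Type*} [Field K] (I : Ideal (MvPolynomial (Fin 4) K)) :
    Ideal (MvPolynomial (Fin 4) K) :=
  Ideal.span (initialForm '' (I : Set (MvPolynomial (Fin 4) K)))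

/-- The negative degree reverse lexicographic order on exponent vectors, for the order of the
variables in which `X i` is smaller than `X j` iff `σ i < σ j`: the monomial `X ^ a` is smaller
than `X ^ b` iff it has larger total degree, or the degrees agree and, at the smallest variable
where the exponents differ, `a` has the larger exponent. -/
def NegDegRevLexLT (σ : Equiv.Perm (Fin 4)) (a b : Fin 4 →₀ ℕ) : Prop :=
  b.degree < a.degree ∨
    (a.degree = b.degree ∧ ∃ i, b i < a i ∧ ∀ j, σ j < σ i → a j = b j)

/-- `X ^ a` is the leading (that is, largest) monomial of `f`. -/
def IsLeadingExponent {K : Type*} [Field K] (σ : Equiv.Perm (Fin 4))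
    (f : MvPolynomial (Fin 4) K) (a : Fin 4 →₀ ℕ) : Prop :=
  a ∈ f.support ∧ ∀ b ∈ f.support, b ≠ a → NegDegRevLexLT σ b a

/-- The ideal generated by the leading monomials of the nonzero elements of `F`. -/
noncomputable def leadingIdeal {K : Type*} [Field K] (σ : Equiv.Perm (Fin 4))
    (F : Set (MvPolynomial (Fin 4) K)) : Ideal (MvPolynomial (Fin 4) K) :=
  Ideal.span {m | ∃ f ∈ F, ∃ a, IsLeadingExponent σ f a ∧ m = monomial a 1}

/-- The finite family `g` is a minimal standard basis of `I`: its members are nonzero elements of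
`I`, their leading monomials generate the leading ideal of `I`, and none of these leading
monomials divides another. -/
structure IsMinimalStandardBasis {K : Type*} [Field K] (σ : Equiv.Perm (Fin 4)) {r : ℕ}
    (g : Fin r → MvPolynomial (Fin 4) K) (I : Ideal (MvPolynomial (Fin 4) K)) : Prop where
  mem : ∀ i, g i ∈ I
  ne_zero : ∀ i, g i ≠ 0
  leadingIdeal_eq :
    leadingIdeal σ (Set.range g) = leadingIdeal σ (I : Set (MvPolynomial (Fin 4) K))
  not_dvd : ∀ i j, i ≠ j → ∀ a b, IsLeadingExponent σ (g i) a → IsLeadingExponent σ (g j) b →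
    ¬ (monomial a (1 : K) ∣ monomial b (1 : K))

/-- The binomials `f₁, …, f₅` attached to the integers `α₂₁, α₁, α₂, α₃, α₄`. -/
noncomputable def curveBinomials (K : Type*) [Field K] (α₂₁ α₁ α₂ α₃ α₄ : ℕ) :
    Fin 5 → MvPolynomial (Fin 4) K :=
  ![X 0 ^ α₁ - X 2 * X 3 ^ (α₄ - 1),
    X 1 ^ α₂ - X 0 ^ α₂₁ * X 3,
    X 2 ^ α₃ - X 0 ^ (α₁ - α₂₁ - 1) * X 1,
    X 3 ^ α₄ - X 0 * X 1 ^ (α₂ - 1) * X 2 ^ (α₃ - 1),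
    X 2 ^ (α₃ - 1) * X 0 ^ (α₂₁ + 1) - X 1 * X 3 ^ (α₄ - 1)]

/-!
As a vector space the tangent cone has the `t ^ w`, with `w` in the semigroup, as a basis: a
monomial represents `t ^ w`, where `w` is its weight, if its degree is the largest possible for that
weight, and vanishes otherwise. Since `n₁` is minimal, the cone is integral over `K[X₁]`, so it is
Cohen–Macaulay if and only if `X₁` is a nonzerodivisor on it, that is, if and only if multiplication
by `X₁` preserves maximality of the degree.

Read each `f_k` as a rule replacing its term free of `X₁` by the other one. The rules raise the
exponent of `X₁` and keep the weight, so every weight has a normal form; at most `n₁` normal forms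
are free of `X₁`, hence normal forms are unique, and those free of `X₁` realize the Apéry set of
`n₁`. If no rule lowers the degree, then all normal forms have maximal degree, a property which
multiplication by `X₁` preserves, and the `X₁`-free terms are the leading monomials. Conversely,
`f₂`, `f₃`, `f₄` have second terms which are a power of `X₁` times an `X₁`-free normal form; if
`X₁` is a nonzerodivisor they have maximal degree, which gives the three inequalities. For `f₁` the
degree condition `α₄ ≤ α₁` follows from the minimality of `n₁`, and for `f₅` it is
`α₄ ≤ α₂ + α₃ - 1 ≤ α₂₁ + α₃`.
-/

theorem ringKrullDim_le_of_isIntegral (D R : Type*) [CommRing D] [CommRing R] [Algebra D R]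
    [Algebra.IsIntegral D R] : ringKrullDim R ≤ ringKrullDim D :=
  Order.krullDim_le_of_strictMono (PrimeSpectrum.comap (algebraMap D R)) fun _ _ hpq =>
    Ideal.IsIntegral.comap_lt_comap hpq

theorem isCohenMacaulayLocal_of_isSMulRegular {R : Type*} [CommRing R] [IsLocalRing R]
    [IsNoetherianRing R] [Ring.KrullDimLE 1 R] {x : R} (hx : IsSMulRegular R x)
    (hxm : x ∈ IsLocalRing.maximalIdeal R) : IsCohenMacaulayLocal R := by
  refine ⟨[x], by simpa using hxm, ?_, ?_⟩
  · rwa [IsLocalRing.isRegular_iff_isWeaklyRegular_of_subset_maximalIdeal (by simpa using hxm),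
      RingTheory.Sequence.isWeaklyRegular_singleton_iff]
  · have : Nontrivial (R ⧸ Ideal.span {x}) := Ideal.Quotient.nontrivial_iff.2 <| ne_top_of_le_ne_top
      (IsLocalRing.maximalIdeal.isMaximal R).ne_top ((Ideal.span_singleton_le_iff_mem _).2 hxm)
    have hdim : ringKrullDim R ≤ 1 := Order.KrullDimLE.krullDim_le
    have hsucc := ringKrullDim_quotient_span_singleton_succ_eq_ringKrullDim hx hxm
    have hnonneg : 0 ≤ ringKrullDim (R ⧸ Ideal.span {x}) := ringKrullDim_nonneg_of_nontrivial
    refine le_antisymm ?_ hdim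
    rw [← hsucc]
    simpa using add_le_add_left hnonneg 1

theorem isCohenMacaulay_of_isIntegral (D : Type*) {R : Type*} [CommRing D] [IsDomain D]
    [Ring.KrullDimLE 1 D] (hD : ¬ IsField D) [CommRing R] [IsNoetherianRing R] [Algebra D R]
    [Algebra.IsIntegral D R] [Module.IsTorsionFree D R] : IsCohenMacaulay R := by
  refine ⟨inferInstance, fun p hp => ?_⟩
  have hmax : (p.comap (algebraMap D R)).IsMaximal :=
    Ideal.isMaximal_comap_of_isIntegral_of_isMaximal p
  obtain ⟨d, hd, hd0⟩ := Submodule.exists_mem_ne_zero_of_ne_bot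
    (Ring.ne_bot_of_isMaximal_of_not_isField hmax hD)
  have : IsNoetherianRing (Localization.AtPrime p) :=
    IsLocalization.isNoetherianRing p.primeCompl _ inferInstance
  have hdim : ringKrullDim (Localization.AtPrime p) ≤ 1 := by
    rw [IsLocalization.AtPrime.ringKrullDim_eq_height p]
    exact Ideal.height_le_ringKrullDim_of_ne_top hp.ne_top |>.trans <|
      (ringKrullDim_le_of_isIntegral D R).trans Order.KrullDimLE.krullDim_le
  have : Ring.KrullDimLE 1 (Localization.AtPrime p) := ⟨hdim⟩
  have hreg : IsSMulRegular R (algebraMap D R d) := fun x y h =>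
    (IsRegular.of_ne_zero hd0).isSMulRegular (by simpa [Algebra.smul_def] using h)
  refine isCohenMacaulayLocal_of_isSMulRegular (hreg.of_isLocalization _ p.primeCompl) ?_
  rw [← Localization.AtPrime.map_eq_maximalIdeal]
  exact Ideal.mem_map_of_mem _ hd

theorem IsCohenMacaulay.eq_zero_of_le_radical_torsionOf {R : Type*} [CommRing R]
    (hR : IsCohenMacaulay R) {p : Ideal R} [p.IsMaximal] (hp : p ∉ minimalPrimes R) {z : R}
    (hz : p ≤ (Ideal.torsionOf R R z).radical) : z = 0 := by
  set S := Localization.AtPrime p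
  obtain ⟨rs, hrs, hreg, hdim⟩ := hR.2 p
  have hz_local : algebraMap R S z = 0 := by
    cases rs with
    | nil =>
      rw [IsLocalization.AtPrime.ringKrullDim_eq_height p] at hdim
      exact (hp (Ideal.height_eq_zero_iff.1 (by exact_mod_cast hdim.symm))).elim
    | cons r rs =>
      have hle : IsLocalRing.maximalIdeal S ≤
          (Ideal.torsionOf S S (algebraMap R S z)).radical := by
        rw [← Localization.AtPrime.map_eq_maximalIdeal, Ideal.map_le_iff_le_comap]
        intro y hy
        obtain ⟨k, hk⟩ := hz hy
        refine ⟨k, ?_⟩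
        rw [Ideal.mem_torsionOf_iff, smul_eq_mul] at hk ⊢
        rw [← map_pow, ← map_mul, hk, map_zero]
      obtain ⟨k, hk⟩ := hle (hrs r List.mem_cons_self)
      have hr : IsSMulRegular S r := ((RingTheory.Sequence.isRegular_cons_iff _ _ _).1 hreg).1
      exact (hr.pow k) (by simpa using hk)
  obtain ⟨s, hs⟩ := (IsLocalization.map_eq_zero_iff p.primeCompl S z).1 hz_local
  have htop : Ideal.torsionOf R R z = ⊤ := by
    rw [← Ideal.radical_eq_top]
    by_contra hne
    exact s.2 <| (Ideal.IsMaximal.eq_of_le ‹_› hne hz).ge <|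
      Ideal.le_radical ((Ideal.mem_torsionOf_iff _ _).2 hs)
  simpa using (Ideal.eq_top_iff_one _).1 htop

theorem exists_mul_pow_eq_zero_of_mem_minimalPrimes {R : Type*} [CommRing R] {p : Ideal R}
    (hp : p ∈ minimalPrimes R) {x : R} (hx : x ∈ p) : ∃ s ∉ p, ∃ k : ℕ, s * x ^ k = 0 := by
  have : p.IsPrime := hp.1.1
  have hnil : algebraMap R (Localization.AtPrime p) x ∈
      ((⊥ : Ideal R).map (algebraMap R (Localization.AtPrime p))).radical := by
    rw [IsLocalization.AtPrime.radical_map_of_mem_minimalPrimes _ p ⊥ hp]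
    exact Ideal.mem_map_of_mem _ hx
  obtain ⟨k, hk⟩ := hnil
  rw [Ideal.map_bot, Ideal.mem_bot, ← map_pow,
    IsLocalization.map_eq_zero_iff p.primeCompl] at hk
  obtain ⟨s, hs⟩ := hk
  exact ⟨s, s.2, k, hs⟩

theorem ker_constantCoeff_eq_idealOfVars (σ R : Type*) [CommRing R] :
    RingHom.ker (constantCoeff : MvPolynomial σ R →+* R) = idealOfVars σ R := by
  ext f
  rw [idealOfVars, ← Set.image_univ, mem_ideal_span_X_image, RingHom.mem_ker, constantCoeff_eq,
    ← notMem_support_iff]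
  refine ⟨fun h0 e he => ?_, fun h h0 => by simpa using h 0 h0⟩
  simpa [Finsupp.ext_iff] using fun h : e = 0 => h0 (h ▸ he)

section Weight

variable {ι : Type*} {n : ι → ℕ}

theorem degree_mul_le_weight {m : ℕ} (hm : ∀ i, m ≤ n i) (e : ι →₀ ℕ) :
    e.degree * m ≤ Finsupp.weight n e := by
  rw [Finsupp.weight_apply, Finsupp.degree_apply, Finset.sum_mul]
  exact Finset.sum_le_sum fun i _ => Nat.mul_le_mul_left _ (hm i)

/-- The exponent `e` has the largest degree among all exponents of the same weight; in terms of the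
semigroup generated by the `n i`, its degree is the order of its weight. -/
def IsMaxDegree (n : ι → ℕ) (e : ι →₀ ℕ) : Prop :=
  ∀ v, Finsupp.weight n v = Finsupp.weight n e → v.degree ≤ e.degree

theorem IsMaxDegree.congr {e v : ι →₀ ℕ} (he : IsMaxDegree n e)
    (hw : Finsupp.weight n v = Finsupp.weight n e) (hd : e.degree ≤ v.degree) :
    IsMaxDegree n v := fun u hu => (he u (hu.trans hw)).trans hd

theorem IsMaxDegree.of_add {u e : ι →₀ ℕ} (h : IsMaxDegree n (u + e)) : IsMaxDegree n e := by
  intro v hv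
  simpa using h (u + v) (by simp [hv])

theorem isMaxDegree_single {i₀ : ι} (h₀ : 0 < n i₀) (hmin : ∀ i, n i₀ ≤ n i) (k : ℕ) :
    IsMaxDegree n (Finsupp.single i₀ k) := by
  intro v hv
  have hle := degree_mul_le_weight hmin v
  rw [hv, Finsupp.weight_single, smul_eq_mul] at hle
  simpa using Nat.le_of_mul_le_mul_right hle h₀

theorem exists_isMaxDegree (hn : ∀ i, 0 < n i) (e : ι →₀ ℕ) :
    ∃ v, Finsupp.weight n v = Finsupp.weight n e ∧ IsMaxDegree n v := by
  let s : Set ℕ := Finsupp.degree '' {v | Finsupp.weight n v = Finsupp.weight n e}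
  have hbdd : BddAbove s := by
    refine ⟨Finsupp.weight n e, ?_⟩
    rintro _ ⟨v, hv : _ = _, rfl⟩
    simpa [hv] using degree_mul_le_weight (m := 1) hn v
  obtain ⟨v, hv, hvs⟩ := Nat.sSup_mem (s := s) ⟨_, e, rfl, rfl⟩ hbdd
  exact ⟨v, hv, fun u hu => hvs ▸ le_csSup hbdd ⟨u, hu.trans hv, rfl⟩⟩

end Weight

section InitialForm

variable {K : Type*} [Field K]

theorem initialForm_eq_homogeneousComponent {f : MvPolynomial (Fin 4) K} {d : ℕ}
    (hd : ∀ e ∈ f.support, d ≤ e.degree) (h : homogeneousComponent d f ≠ 0) :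
    initialForm f = homogeneousComponent d f := by
  have hleast : IsLeast {k | homogeneousComponent k f ≠ 0} d := by
    refine ⟨h, fun k hk => le_of_not_gt fun hlt => hk ?_⟩
    exact homogeneousComponent_eq_zero' _ _ fun e he => (hlt.trans_le (hd e he)).ne'
  rw [initialForm, hleast.csInf_eq]

theorem sInf_homogeneousComponent_ne_zero_le_degree {f : MvPolynomial (Fin 4) K}
    {e : Fin 4 →₀ ℕ} (he : e ∈ f.support) :
    sInf {d | homogeneousComponent d f ≠ 0} ≤ e.degree := by
  refine Nat.sInf_le fun h => mem_support_iff.1 he ?_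
  simpa [coeff_homogeneousComponent] using congrArg (coeff e) h

theorem homogeneousComponent_monomial_mul {σ R : Type*} [CommSemiring R] (u : σ →₀ ℕ) (c : R)
    (d : ℕ) (f : MvPolynomial σ R) : homogeneousComponent (u.degree + d) (monomial u c * f) =
      monomial u c * homogeneousComponent d f := by
  induction f using MvPolynomial.induction_on' with
  | monomial e b =>
    rw [monomial_mul, homogeneousComponent_of_mem (isHomogeneous_monomial _ rfl),
      homogeneousComponent_of_mem (isHomogeneous_monomial _ rfl), map_add]
    simp only [Nat.add_left_cancel_iff, mul_ite, monomial_mul, mul_zero]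
  | add p q hp hq => rw [mul_add, map_add, map_add, mul_add, hp, hq]

theorem initialForm_monomial_sub_monomial_of_degree_lt {a b : Fin 4 →₀ ℕ}
    (h : a.degree < b.degree) :
    initialForm (monomial a (1 : K) - monomial b 1) = monomial a 1 := by
  classical
  have hcomp : homogeneousComponent a.degree (monomial a (1 : K) - monomial b 1) =
      monomial a 1 := by
    rw [map_sub, homogeneousComponent_of_mem (isHomogeneous_monomial _ rfl),
      homogeneousComponent_of_mem (isHomogeneous_monomial _ rfl), if_pos rfl, if_neg h.ne, sub_zero]
  have hne : homogeneousComponent a.degree (monomial a (1 : K) - monomial b 1) ≠ 0 := by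
    simp only [hcomp, ne_eq, monomial_eq_zero, one_ne_zero, not_false_eq_true]
  rw [initialForm_eq_homogeneousComponent (fun e he => ?_) hne, hcomp]
  have := Finset.mem_union.1 (support_sub _ _ _ he)
  simp only [support_monomial, one_ne_zero, if_false, Finset.mem_singleton] at this
  rcases this with rfl | rfl
  exacts [le_rfl, h.le]

theorem initialForm_of_isHomogeneous {f : MvPolynomial (Fin 4) K} {d : ℕ}
    (hf : f.IsHomogeneous d) : initialForm f = f := by
  rcases eq_or_ne f 0 with rfl | h0
  · exact map_zero _
  · rw [initialForm_eq_homogeneousComponent (d := d) (fun e he => ?_),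
      homogeneousComponent_of_mem hf, if_pos rfl]
    · rwa [homogeneousComponent_of_mem hf, if_pos rfl]
    · exact le_of_eq (by_contra fun hd => mem_support_iff.1 he (hf.coeff_eq_zero (Ne.symm hd)))

end InitialForm

section TangentCone

variable {K : Type*} [Field K] {n : Fin 4 → ℕ}

theorem aeval_X_pow_monomial (e : Fin 4 →₀ ℕ) (c : K) :
    aeval (fun i => (Polynomial.X : Polynomial K) ^ n i) (monomial e c) =
      Polynomial.monomial (Finsupp.weight n e) c := by
  simp only [aeval_monomial, Finsupp.prod, ← pow_mul, Finset.prod_pow_eq_pow_sum,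
    Polynomial.algebraMap_eq, Polynomial.C_mul_X_pow_eq_monomial, Finsupp.weight_apply,
    Finsupp.sum, smul_eq_mul, mul_comm]

theorem monomial_sub_monomial_mem_curveIdeal {a b : Fin 4 →₀ ℕ}
    (h : Finsupp.weight n a = Finsupp.weight n b) :
    monomial a (1 : K) - monomial b 1 ∈ curveIdeal K n := by
  rw [curveIdeal, RingHom.mem_ker, map_sub, aeval_X_pow_monomial, aeval_X_pow_monomial, h,
    sub_self]

theorem sum_coeff_eq_zero_of_mem_curveIdeal {f : MvPolynomial (Fin 4) K}
    (hf : f ∈ curveIdeal K n) (w : ℕ) :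
    ∑ e ∈ f.support with Finsupp.weight n e = w, coeff e f = 0 := by
  have hw := congrArg (Polynomial.coeff · w) (RingHom.mem_ker.1 hf)
  rw [f.as_sum, map_sum] at hw
  simpa only [Polynomial.finsetSum_coeff, aeval_X_pow_monomial, Polynomial.coeff_monomial,
    Polynomial.coeff_zero, Finset.sum_filter] using hw

theorem exists_ne_mem_support_of_mem_curveIdeal {f : MvPolynomial (Fin 4) K}
    (hf : f ∈ curveIdeal K n) {a : Fin 4 →₀ ℕ} (ha : a ∈ f.support) :
    ∃ e ∈ f.support, e ≠ a ∧ Finsupp.weight n e = Finsupp.weight n a := by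
  by_contra! h
  refine mem_support_iff.1 ha ?_
  rw [← sum_coeff_eq_zero_of_mem_curveIdeal hf (Finsupp.weight n a), eq_comm]
  refine Finset.sum_eq_single_of_mem a (Finset.mem_filter.2 ⟨ha, rfl⟩) fun e he hea => ?_
  exact absurd (Finset.mem_filter.1 he).2 (h e (Finset.mem_filter.1 he).1 hea)

theorem monomial_mem_tangentConeIdeal_of_degree_lt {a b : Fin 4 →₀ ℕ}
    (hw : Finsupp.weight n a = Finsupp.weight n b) (hd : a.degree < b.degree) :
    monomial a (1 : K) ∈ tangentConeIdeal (curveIdeal K n) :=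
  Ideal.subset_span ⟨_, monomial_sub_monomial_mem_curveIdeal hw,
    initialForm_monomial_sub_monomial_of_degree_lt hd⟩

theorem monomial_sub_monomial_mem_tangentConeIdeal {a b : Fin 4 →₀ ℕ}
    (hw : Finsupp.weight n a = Finsupp.weight n b) (hd : a.degree = b.degree) :
    monomial a (1 : K) - monomial b 1 ∈ tangentConeIdeal (curveIdeal K n) :=
  Ideal.subset_span ⟨_, monomial_sub_monomial_mem_curveIdeal hw,
    initialForm_of_isHomogeneous <|
      (isHomogeneous_monomial 1 hd).sub (isHomogeneous_monomial 1 rfl)⟩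

open Classical in
/-- The linear map from `K[X₁, …, X₄]` to `K[t]` which identifies the tangent cone with the
semigroup algebra as a vector space: a monomial goes to `t ^ w`, where `w` is its weight, if its
degree is the largest possible for that weight, and to zero otherwise. -/
noncomputable def coneMap (K : Type*) [Field K] (n : Fin 4 → ℕ) :
    MvPolynomial (Fin 4) K →ₗ[K] Polynomial K :=
  (basisMonomials (Fin 4) K).constr K
    (fun e => if IsMaxDegree n e then Polynomial.monomial (Finsupp.weight n e) 1 else 0)

open Classical in
theorem coneMap_monomial (e : Fin 4 →₀ ℕ) (c : K) :
    coneMap K n (monomial e c) =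
      if IsMaxDegree n e then Polynomial.monomial (Finsupp.weight n e) c else 0 := by
  have hone : coneMap K n (monomial e 1) = _ := (basisMonomials (Fin 4) K).constr_basis K _ e
  rw [← mul_one c, ← smul_eq_mul, ← smul_monomial, map_smul, hone, smul_ite, smul_zero,
    Polynomial.smul_monomial]

open Classical in
theorem coeff_coneMap (h : MvPolynomial (Fin 4) K) (w : ℕ) :
    (coneMap K n h).coeff w =
      ∑ e ∈ h.support with IsMaxDegree n e ∧ Finsupp.weight n e = w, coeff e h := by
  conv_lhs => rw [h.as_sum, map_sum, Polynomial.finsetSum_coeff]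
  rw [Finset.sum_filter]
  refine Finset.sum_congr rfl fun e _ => ?_
  rw [coneMap_monomial, ite_and]
  split_ifs with he hw <;> simp [Polynomial.coeff_monomial, *]

theorem coneMap_homogeneousComponent_eq_zero {f : MvPolynomial (Fin 4) K}
    (hf : f ∈ curveIdeal K n) {d : ℕ} (hd : ∀ e ∈ f.support, d ≤ e.degree) :
    coneMap K n (homogeneousComponent d f) = 0 := by
  classical
  ext w
  rw [coeff_coneMap, Polynomial.coeff_zero, support_homogeneousComponent, Finset.filter_filter]
  by_cases hex : ∃ e₀, e₀.degree = d ∧ IsMaxDegree n e₀ ∧ Finsupp.weight n e₀ = w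
  · obtain ⟨e₀, rfl, hmax, rfl⟩ := hex
    rw [← sum_coeff_eq_zero_of_mem_curveIdeal hf (Finsupp.weight n e₀)]
    have hfilter : {e ∈ f.support | e.degree = e₀.degree ∧ IsMaxDegree n e ∧
        Finsupp.weight n e = Finsupp.weight n e₀} =
        {e ∈ f.support | Finsupp.weight n e = Finsupp.weight n e₀} := by
      refine Finset.filter_congr fun e he => ⟨fun h => h.2.2, fun hw => ?_⟩
      exact ⟨(hmax e hw).antisymm (hd e he), hmax.congr hw (hd e he), hw⟩
    rw [hfilter]
    refine Finset.sum_congr rfl fun e he => ?_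
    rw [coeff_homogeneousComponent, if_pos]
    exact (hmax e (Finset.mem_filter.1 he).2).antisymm (hd e (Finset.mem_filter.1 he).1)
  · rw [Finset.filter_false_of_mem fun e _ he => hex ⟨e, he⟩, Finset.sum_empty]

theorem coneMap_monomial_mul_initialForm {f : MvPolynomial (Fin 4) K}
    (hf : f ∈ curveIdeal K n) (u : Fin 4 →₀ ℕ) (c : K) :
    coneMap K n (monomial u c * initialForm f) = 0 := by
  classical
  rw [initialForm, ← homogeneousComponent_monomial_mul]
  refine coneMap_homogeneousComponent_eq_zero (Ideal.mul_mem_left _ _ hf) fun e he => ?_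
  obtain ⟨v, hv, e', he', rfl⟩ := Finset.mem_add.1 (support_mul _ _ he)
  rw [Finset.mem_singleton.1 (support_monomial_subset hv), map_add]
  exact Nat.add_le_add_left (sInf_homogeneousComponent_ne_zero_le_degree he') _

theorem coneMap_eq_zero_of_mem_tangentConeIdeal {h : MvPolynomial (Fin 4) K}
    (hh : h ∈ tangentConeIdeal (curveIdeal K n)) : coneMap K n h = 0 := by
  obtain ⟨N, q, f, rfl⟩ := Submodule.mem_span_set'.1 hh
  rw [map_sum]
  refine Finset.sum_eq_zero fun i _ => ?_
  obtain ⟨g, hg, hgf⟩ := (f i).2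
  rw [smul_eq_mul, ← hgf, (q i).as_sum, Finset.sum_mul, map_sum]
  exact Finset.sum_eq_zero fun u _ => coneMap_monomial_mul_initialForm hg u _

theorem mem_tangentConeIdeal_of_coneMap_eq_zero (hn : ∀ i, 0 < n i)
    {h : MvPolynomial (Fin 4) K} (hh : coneMap K n h = 0) :
    h ∈ tangentConeIdeal (curveIdeal K n) := by
  classical
  choose m hmw hmax using exists_isMaxDegree hn
  let M (w : ℕ) : Fin 4 →₀ ℕ := m (Function.invFun (Finsupp.weight n) w)
  have hM (e : Fin 4 →₀ ℕ) : Finsupp.weight n (M (Finsupp.weight n e)) = Finsupp.weight n e :=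
    (hmw _).trans (Function.invFun_eq (f := Finsupp.weight n) ⟨e, rfl⟩)
  let L : Polynomial K →ₗ[K] MvPolynomial (Fin 4) K :=
    (Polynomial.basisMonomials K).constr K fun w => monomial (M w) 1
  have hL (w : ℕ) : L (Polynomial.monomial w 1) = _ :=
    (Polynomial.basisMonomials K).constr_basis K _ w
  let π := (Ideal.Quotient.mkₐ K (tangentConeIdeal (curveIdeal K n))).toLinearMap
  have hπ : π ∘ₗ L ∘ₗ coneMap K n = π := by
    refine (basisMonomials (Fin 4) K).ext fun e => Ideal.Quotient.eq.2 ?_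
    have hle := hmax _ e (hM e).symm
    rw [coe_basisMonomials, LinearMap.comp_apply, coneMap_monomial]
    split_ifs with he
    · rw [hL]
      exact monomial_sub_monomial_mem_tangentConeIdeal (hM e) ((he _ (hM e)).antisymm hle)
    · rw [map_zero, zero_sub, neg_mem_iff]
      exact monomial_mem_tangentConeIdeal_of_degree_lt (hM e).symm
        (hle.lt_of_not_ge fun hge => he ((hmax _).congr (hM e).symm hge))
  rw [← Ideal.Quotient.eq_zero_iff_mem]
  calc Ideal.Quotient.mk _ h = π (L (coneMap K n h)) := (LinearMap.congr_fun hπ h).symm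
    _ = 0 := by rw [hh, map_zero, map_zero]

theorem mem_tangentConeIdeal_iff (hn : ∀ i, 0 < n i) {h : MvPolynomial (Fin 4) K} :
    h ∈ tangentConeIdeal (curveIdeal K n) ↔ coneMap K n h = 0 :=
  ⟨coneMap_eq_zero_of_mem_tangentConeIdeal, mem_tangentConeIdeal_of_coneMap_eq_zero hn⟩

theorem monomial_mem_tangentConeIdeal_iff (hn : ∀ i, 0 < n i) {e : Fin 4 →₀ ℕ} :
    monomial e (1 : K) ∈ tangentConeIdeal (curveIdeal K n) ↔ ¬ IsMaxDegree n e := by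
  classical
  rw [mem_tangentConeIdeal_iff hn, coneMap_monomial, ite_eq_right_iff,
    Polynomial.monomial_eq_zero_iff]
  simp only [one_ne_zero, imp_false]

end TangentCone

section CohenMacaulayCriterion

variable {K : Type*} [Field K] {n : Fin 4 → ℕ} {i₀ : Fin 4}

theorem exists_X_pow_sub_mem_tangentConeIdeal (hmin : ∀ i, n i₀ ≤ n i) (i : Fin 4) :
    ∃ c : K, X i ^ n i₀ - C c * X i₀ ^ n i₀ ∈ tangentConeIdeal (curveIdeal K n) := by
  have hw : Finsupp.weight n (Finsupp.single i (n i₀)) =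
      Finsupp.weight n (Finsupp.single i₀ (n i)) := by
    simp only [Finsupp.weight_single, smul_eq_mul, mul_comm]
  rcases (hmin i).lt_or_eq with h | h
  · refine ⟨0, ?_⟩
    rw [C_0, zero_mul, sub_zero, X_pow_eq_monomial]
    exact monomial_mem_tangentConeIdeal_of_degree_lt hw (by simpa using h)
  · refine ⟨1, ?_⟩
    rw [C_1, one_mul, X_pow_eq_monomial, X_pow_eq_monomial]
    rw [← h] at hw
    exact monomial_sub_monomial_mem_tangentConeIdeal hw (by simp)

theorem coneMap_X_mul (hX : ∀ e, IsMaxDegree n e → IsMaxDegree n (Finsupp.single i₀ 1 + e))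
    (h : MvPolynomial (Fin 4) K) :
    coneMap K n (X i₀ * h) = Polynomial.X ^ n i₀ * coneMap K n h := by
  classical
  induction h using MvPolynomial.induction_on' with
  | monomial e c =>
    rw [X, monomial_mul, coneMap_monomial, coneMap_monomial, one_mul]
    by_cases he : IsMaxDegree n e
    · rw [if_pos he, if_pos (hX e he), Polynomial.X_pow_mul_monomial, map_add,
        Finsupp.weight_single, one_smul, add_comm]
    · rw [if_neg he, if_neg fun h => he h.of_add, mul_zero]
  | add p q hp hq => rw [mul_add, map_add, map_add, mul_add, hp, hq]

theorem coneMap_aeval_X_mul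
    (hX : ∀ e, IsMaxDegree n e → IsMaxDegree n (Finsupp.single i₀ 1 + e))
    (g : Polynomial K) (h : MvPolynomial (Fin 4) K) :
    coneMap K n (Polynomial.aeval (X i₀) g * h) =
      Polynomial.expand K (n i₀) g * coneMap K n h := by
  induction g using Polynomial.induction_on with
  | C a => simp [← Polynomial.smul_eq_C_mul, algebraMap_eq, ← smul_eq_C_mul]
  | add p q hp hq => rw [map_add, map_add, add_mul, add_mul, map_add, hp, hq]
  | monomial k c ih =>
    rw [pow_succ', mul_left_comm, map_mul (Polynomial.aeval _), map_mul (Polynomial.expand K _),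
      mul_assoc, mul_assoc, Polynomial.aeval_X, Polynomial.expand_X, coneMap_X_mul hX, ih]

theorem isIntegral_mk_comp_aeval_X {σ R : Type*} [CommRing R] {J : Ideal (MvPolynomial σ R)}
    {j : σ} {m : ℕ} (hm : 0 < m) (hJ : ∀ i, ∃ c : R, X i ^ m - C c * X j ^ m ∈ J) :
    ((Ideal.Quotient.mk J).comp
      (Polynomial.aeval (R := R) (X j : MvPolynomial σ R)).toRingHom).IsIntegral := by
  set φ := (Ideal.Quotient.mk J).comp (Polynomial.aeval (R := R) (X j)).toRingHom
  let := φ.toAlgebra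
  intro z
  change IsIntegral (Polynomial R) z
  obtain ⟨q, rfl⟩ := Ideal.Quotient.mk_surjective z
  induction q using MvPolynomial.induction_on with
  | C a =>
    have : Ideal.Quotient.mk J (C a) = φ (Polynomial.C a) := by simp [φ, algebraMap_eq]
    exact this ▸ isIntegral_algebraMap
  | add p q hp hq => exact map_add (Ideal.Quotient.mk J) p q ▸ hp.add hq
  | mul_X p i hp =>
    refine map_mul (Ideal.Quotient.mk J) p (X i) ▸ hp.mul (IsIntegral.of_pow hm ?_)
    obtain ⟨c, hc⟩ := hJ i
    have : Ideal.Quotient.mk J (X i) ^ m = φ (Polynomial.C c * Polynomial.X ^ m) := by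
      rw [← map_pow, Ideal.Quotient.eq.2 hc]
      simp [φ, algebraMap_eq]
    exact this ▸ isIntegral_algebraMap

theorem isCohenMacaulay_tangentCone_of_isMaxDegree_single_add (h₀ : 0 < n i₀)
    (hmin : ∀ i, n i₀ ≤ n i)
    (hX : ∀ e, IsMaxDegree n e → IsMaxDegree n (Finsupp.single i₀ 1 + e)) :
    IsCohenMacaulay (MvPolynomial (Fin 4) K ⧸ tangentConeIdeal (curveIdeal K n)) := by
  set J := tangentConeIdeal (curveIdeal K n) with hJ
  have hn (i) : 0 < n i := h₀.trans_le (hmin i)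
  let φ := (Ideal.Quotient.mk J).comp (Polynomial.aeval (R := K) (X i₀)).toRingHom
  let := φ.toAlgebra
  have hint : Algebra.IsIntegral (Polynomial K) (MvPolynomial (Fin 4) K ⧸ J) :=
    ⟨isIntegral_mk_comp_aeval_X h₀ (exists_X_pow_sub_mem_tangentConeIdeal hmin)⟩
  have htors : Module.IsTorsionFree (Polynomial K) (MvPolynomial (Fin 4) K ⧸ J) := by
    refine Module.IsTorsionFree.of_smul_eq_zero fun g z hz => ?_
    obtain ⟨h, rfl⟩ := Ideal.Quotient.mk_surjective z
    have hmul : Ideal.Quotient.mk J (Polynomial.aeval (X i₀) g * h) = 0 :=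
      (map_mul _ _ _).trans hz
    rw [Ideal.Quotient.eq_zero_iff_mem, hJ, mem_tangentConeIdeal_iff hn,
      coneMap_aeval_X_mul hX, mul_eq_zero, Polynomial.expand_eq_zero h₀] at hmul
    rwa [Ideal.Quotient.eq_zero_iff_mem, hJ, mem_tangentConeIdeal_iff hn]
  exact isCohenMacaulay_of_isIntegral (Polynomial K) (Polynomial.not_isField K)

theorem coeff_coneMap_X_pow_mul (h₀ : 0 < n i₀) (hmin : ∀ i, n i₀ ≤ n i) (k : ℕ)
    (s : MvPolynomial (Fin 4) K) :
    (coneMap K n (X i₀ ^ k * s)).coeff (k * n i₀) = constantCoeff s := by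
  classical
  induction s using MvPolynomial.induction_on' with
  | monomial e c =>
    rw [X_pow_eq_monomial, monomial_mul, one_mul, coneMap_monomial, constantCoeff_monomial]
    rcases eq_or_ne e 0 with rfl | he
    · rw [add_zero, if_pos (isMaxDegree_single h₀ hmin k), if_pos rfl,
        Finsupp.weight_single, smul_eq_mul, Polynomial.coeff_monomial_same]
    · have hdeg : 0 < e.degree * n i₀ :=
        Nat.mul_pos (Nat.pos_of_ne_zero ((Finsupp.degree_eq_zero_iff e).not.2 he)) h₀
      have hw : Finsupp.weight n (Finsupp.single i₀ k + e) ≠ k * n i₀ := by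
        rw [map_add, Finsupp.weight_single, smul_eq_mul, Ne, Nat.add_eq_left]
        exact (hdeg.trans_le (degree_mul_le_weight hmin e)).ne'
      rw [if_neg he, apply_ite (Polynomial.coeff · _), Polynomial.coeff_monomial, if_neg hw,
        Polynomial.coeff_zero, ite_self]
  | add p q hp hq => rw [mul_add, map_add, Polynomial.coeff_add, hp, hq, map_add]

theorem constantCoeff_eq_zero_of_mem_tangentConeIdeal (h₀ : 0 < n i₀) (hmin : ∀ i, n i₀ ≤ n i)
    {h : MvPolynomial (Fin 4) K} (hh : h ∈ tangentConeIdeal (curveIdeal K n)) :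
    constantCoeff h = 0 := by
  have := coeff_coneMap_X_pow_mul h₀ hmin 0 h
  rw [pow_zero, one_mul, coneMap_eq_zero_of_mem_tangentConeIdeal hh] at this
  exact this.symm

theorem X_pow_mul_mem_tangentConeIdeal (h₀ : 0 < n i₀) (hmin : ∀ i, n i₀ ≤ n i)
    {h : MvPolynomial (Fin 4) K} (hh : X i₀ * h ∈ tangentConeIdeal (curveIdeal K n)) (i : Fin 4) :
    X i ^ n i₀ * h ∈ tangentConeIdeal (curveIdeal K n) := by
  obtain ⟨c, hc⟩ := exists_X_pow_sub_mem_tangentConeIdeal (K := K) hmin i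
  have hsplit : X i ^ n i₀ * h =
      (X i ^ n i₀ - C c * X i₀ ^ n i₀) * h + C c * X i₀ ^ (n i₀ - 1) * (X i₀ * h) := by
    rw [← mul_assoc, mul_assoc (C c), pow_sub_one_mul h₀.ne']
    ring
  rw [hsplit]
  exact add_mem (Ideal.mul_mem_right _ _ hc) (Ideal.mul_mem_left _ _ hh)

/-- The augmentation `X_i ↦ 0` of the tangent cone; its kernel is the maximal ideal of the
vertex. -/
noncomputable def coneAugmentation (K : Type*) [Field K] (h₀ : 0 < n i₀)
    (hmin : ∀ i, n i₀ ≤ n i) :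
    MvPolynomial (Fin 4) K ⧸ tangentConeIdeal (curveIdeal K n) →+* K :=
  Ideal.Quotient.lift _ constantCoeff fun _ =>
    constantCoeff_eq_zero_of_mem_tangentConeIdeal h₀ hmin

theorem ker_coneAugmentation_notMem_minimalPrimes (h₀ : 0 < n i₀) (hmin : ∀ i, n i₀ ≤ n i) :
    RingHom.ker (coneAugmentation K h₀ hmin) ∉ minimalPrimes _ := by
  intro hmem
  have hX : Ideal.Quotient.mk _ (X i₀) ∈ RingHom.ker (coneAugmentation K h₀ hmin) :=
    constantCoeff_X K i₀
  obtain ⟨s, hs, k, hsk⟩ := exists_mul_pow_eq_zero_of_mem_minimalPrimes hmem hX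
  obtain ⟨s, rfl⟩ := Ideal.Quotient.mk_surjective s
  rw [← map_pow, ← map_mul, Ideal.Quotient.eq_zero_iff_mem, mul_comm] at hsk
  refine hs ?_
  rw [RingHom.mem_ker, coneAugmentation, Ideal.Quotient.lift_mk,
    ← coeff_coneMap_X_pow_mul h₀ hmin k, coneMap_eq_zero_of_mem_tangentConeIdeal hsk,
    Polynomial.coeff_zero]

theorem ker_coneAugmentation_le_radical_torsionOf (h₀ : 0 < n i₀) (hmin : ∀ i, n i₀ ≤ n i)
    {h : MvPolynomial (Fin 4) K} (hh : X i₀ * h ∈ tangentConeIdeal (curveIdeal K n)) :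
    RingHom.ker (coneAugmentation K h₀ hmin) ≤
      (Ideal.torsionOf _ _ (Ideal.Quotient.mk (tangentConeIdeal (curveIdeal K n)) h)).radical := by
  set π := Ideal.Quotient.mk (tangentConeIdeal (curveIdeal K n))
  have hle : idealOfVars (Fin 4) K ≤ ((Ideal.torsionOf _ _ (π h)).radical).comap π := by
    refine Ideal.span_le.2 ?_
    rintro _ ⟨i, rfl⟩
    refine ⟨n i₀, ?_⟩
    rw [Ideal.mem_torsionOf_iff, smul_eq_mul, ← map_pow π, ← map_mul,
      Ideal.Quotient.eq_zero_iff_mem]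
    exact X_pow_mul_mem_tangentConeIdeal h₀ hmin hh i
  intro y hy
  obtain ⟨y, rfl⟩ := Ideal.Quotient.mk_surjective y
  exact hle ((ker_constantCoeff_eq_idealOfVars (Fin 4) K).le hy)

theorem isMaxDegree_single_add_of_isCohenMacaulay (h₀ : 0 < n i₀) (hmin : ∀ i, n i₀ ≤ n i)
    (hCM : IsCohenMacaulay (MvPolynomial (Fin 4) K ⧸ tangentConeIdeal (curveIdeal K n)))
    {e : Fin 4 →₀ ℕ} (he : IsMaxDegree n e) : IsMaxDegree n (Finsupp.single i₀ 1 + e) := by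
  have hn (i) : 0 < n i := h₀.trans_le (hmin i)
  by_contra hcon
  rw [← monomial_mem_tangentConeIdeal_iff (K := K) hn, ← one_mul (1 : K), ← monomial_mul] at hcon
  have : (RingHom.ker (coneAugmentation K h₀ hmin)).IsMaximal :=
    RingHom.ker_isMaximal_of_surjective _ fun a =>
      ⟨Ideal.Quotient.mk _ (C a), constantCoeff_C _ a⟩
  have hzero := hCM.eq_zero_of_le_radical_torsionOf
    (ker_coneAugmentation_notMem_minimalPrimes h₀ hmin)
    (ker_coneAugmentation_le_radical_torsionOf h₀ hmin hcon)
  exact (monomial_mem_tangentConeIdeal_iff hn).1 (Ideal.Quotient.eq_zero_iff_mem.1 hzero) he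

theorem isCohenMacaulay_tangentCone_iff (h₀ : 0 < n i₀) (hmin : ∀ i, n i₀ ≤ n i) :
    IsCohenMacaulay (MvPolynomial (Fin 4) K ⧸ tangentConeIdeal (curveIdeal K n)) ↔
      ∀ e, IsMaxDegree n e → IsMaxDegree n (Finsupp.single i₀ 1 + e) :=
  ⟨fun hCM _ => isMaxDegree_single_add_of_isCohenMacaulay h₀ hmin hCM,
    isCohenMacaulay_tangentCone_of_isMaxDegree_single_add h₀ hmin⟩

end CohenMacaulayCriterion

section AperySystem

theorem exists_cast_weight_eq {ι : Type*} [Fintype ι] {n : ι → ℕ} (hgcd : Finset.univ.gcd n = 1)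
    {m : ℕ} [NeZero m] (z : ZMod m) : ∃ e : ι →₀ ℕ, (Finsupp.weight n e : ZMod m) = z := by
  obtain ⟨c, hc⟩ := Finset.gcd_eq_sum_mul Finset.univ (fun i => (n i : ℤ))
  have hunit : IsUnit (Finset.univ.gcd fun i => (n i : ℤ)) :=
    Int.isUnit_iff_natAbs_eq.2 <| Nat.dvd_one.1 <| hgcd ▸ Finset.dvd_gcd fun i hi =>
      Int.natAbs_dvd_natAbs.2 (Finset.gcd_dvd hi)
  have hgcdInt : (Finset.univ.gcd fun i => (n i : ℤ)) = 1 :=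
    Finset.normalize_gcd.symm.trans (normalize_eq_one.2 hunit)
  have hsum : ∑ i, (n i : ZMod m) * c i = 1 := by
    simpa [hgcdInt] using (congrArg (Int.cast : ℤ → ZMod m) hc).symm
  refine ⟨Finsupp.equivFunOnFinite.symm fun i => (z * c i).val, ?_⟩
  rw [Finsupp.weight_apply, Finsupp.sum_fintype _ _ fun i => zero_smul ℕ (n i)]
  simp [mul_assoc, ← Finset.mul_sum, mul_comm (c _ : ZMod m), hsum]

variable {ι κ : Type*} {n : ι → ℕ} {i₀ : ι} {lead tail : κ → ι →₀ ℕ}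

/-- The monomial `X ^ e` is standard with respect to the monomials `X ^ lead k`: it is divisible by
none of them. -/
def IsStandard (lead : κ → ι →₀ ℕ) (e : ι →₀ ℕ) : Prop :=
  ∀ k, ¬ lead k ≤ e

theorem IsStandard.erase {e : ι →₀ ℕ} (he : IsStandard lead e) (i : ι) :
    IsStandard lead (e.erase i) := fun k hk => he k <| hk.trans <| by
  nth_rw 2 [← Finsupp.single_add_erase i e]
  exact le_add_self

theorem IsStandard.single_add {e : ι →₀ ℕ} (he : IsStandard lead e)
    (hlead : ∀ k, lead k i₀ = 0) (m : ℕ) : IsStandard lead (Finsupp.single i₀ m + e) := by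
  classical
  refine fun k hk => he k fun i => ?_
  rcases eq_or_ne i i₀ with rfl | hi
  · exact (hlead k).trans_le (Nat.zero_le _)
  · simpa [Finsupp.single_eq_of_ne hi] using hk i

/-- Relations `X ^ lead k = X ^ tail k` among the monomials of the semigroup generated by the `n i`,
read as rewriting rules `lead k ↦ tail k` which increase the exponent of `X i₀`. The bound on the
number of standard monomials free of `X i₀` forces their weights to form the Apéry set of the
semigroup with respect to `n i₀`. -/
structure IsAperySystem [Fintype ι] (n : ι → ℕ) (i₀ : ι) (lead tail : κ → ι →₀ ℕ) : Prop where
  pos : 0 < n i₀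
  gcd_eq_one : Finset.univ.gcd n = 1
  weight_lead (k : κ) : Finsupp.weight n (lead k) = Finsupp.weight n (tail k)
  lead_apply (k : κ) : lead k i₀ = 0
  tail_apply_pos (k : κ) : 0 < tail k i₀
  encard_le : {e | IsStandard lead e ∧ e i₀ = 0}.encard ≤ n i₀

namespace IsAperySystem

variable [Fintype ι]

theorem exists_isStandard (h : IsAperySystem n i₀ lead tail) {P : (ι →₀ ℕ) → Prop}
    (hP : ∀ k u, P (lead k + u) → P (tail k + u)) {e : ι →₀ ℕ} (he : P e) :
    ∃ v, IsStandard lead v ∧ Finsupp.weight n v = Finsupp.weight n e ∧ P v := by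
  induction hN : Finsupp.weight n e - e i₀ using Nat.strong_induction_on generalizing e with
  | _ N ih =>
    by_cases hstd : IsStandard lead e
    · exact ⟨e, hstd, rfl, he⟩
    simp only [IsStandard, not_forall, not_not] at hstd
    obtain ⟨k, hk⟩ := hstd
    obtain ⟨u, rfl⟩ := exists_add_of_le hk
    have hw : Finsupp.weight n (tail k + u) = Finsupp.weight n (lead k + u) := by
      rw [map_add, map_add, h.weight_lead]
    have hlt : (lead k + u) i₀ < (tail k + u) i₀ := by
      simpa [h.lead_apply] using h.tail_apply_pos k
    have hle : (tail k + u) i₀ ≤ Finsupp.weight n (tail k + u) :=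
      Finsupp.le_weight n h.pos.ne' _
    obtain ⟨v, hv, hvw, hvP⟩ := ih _ (by omega) (hP k u he) rfl
    exact ⟨v, hv, hvw.trans hw, hvP⟩

theorem injOn_cast_weight (h : IsAperySystem n i₀ lead tail) :
    Set.InjOn (fun e => (Finsupp.weight n e : ZMod (n i₀)))
      {e | IsStandard lead e ∧ e i₀ = 0} := by
  have : NeZero (n i₀) := ⟨h.pos.ne'⟩
  have hfin := Set.finite_of_encard_le_coe h.encard_le
  refine hfin.injOn_of_encard_image_eq (le_antisymm (Set.encard_image_le _ _) ?_)
  suffices himage : (fun e => (Finsupp.weight n e : ZMod (n i₀))) ''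
      {e | IsStandard lead e ∧ e i₀ = 0} = Set.univ by
    rw [himage, Set.encard_univ, ENat.card_eq_coe_fintype_card, ZMod.card]
    exact h.encard_le
  refine Set.eq_univ_of_forall fun z => ?_
  obtain ⟨e, rfl⟩ := exists_cast_weight_eq h.gcd_eq_one z
  obtain ⟨v, hv, hvw, -⟩ :=
    h.exists_isStandard (P := fun _ => True) (fun _ _ => id) (e := e) trivial
  refine ⟨v.erase i₀, ⟨hv.erase i₀, Finsupp.erase_same⟩, ?_⟩
  rw [← hvw]
  nth_rw 2 [← Finsupp.single_add_erase i₀ v]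
  simp [Finsupp.weight_single]

theorem eq_of_isStandard_of_weight_eq (h : IsAperySystem n i₀ lead tail) {e v : ι →₀ ℕ}
    (he : IsStandard lead e) (hv : IsStandard lead v)
    (hw : Finsupp.weight n e = Finsupp.weight n v) : e = v := by
  have hmem {u : ι →₀ ℕ} (hu : IsStandard lead u) : IsStandard lead (u.erase i₀) ∧
    u.erase i₀ i₀ = 0 := ⟨hu.erase i₀, Finsupp.erase_same⟩
  have hsplit (u : ι →₀ ℕ) :
      Finsupp.weight n u = u i₀ * n i₀ + Finsupp.weight n (u.erase i₀) := by
    conv_lhs => rw [← Finsupp.single_add_erase i₀ u]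
    rw [map_add, Finsupp.weight_single, smul_eq_mul]
  rw [hsplit e, hsplit v] at hw
  have herase : e.erase i₀ = v.erase i₀ := by
    refine h.injOn_cast_weight (hmem he) (hmem hv) ?_
    simpa using congrArg (Nat.cast : ℕ → ZMod (n i₀)) hw
  rw [herase, Nat.add_right_cancel_iff] at hw
  rw [← Finsupp.single_add_erase i₀ e, ← Finsupp.single_add_erase i₀ v, herase,
    Nat.eq_of_mul_eq_mul_right h.pos hw]

theorem eq_or_apply_lt (h : IsAperySystem n i₀ lead tail) {e v : ι →₀ ℕ}
    (hv : IsStandard lead v) (hw : Finsupp.weight n e = Finsupp.weight n v) :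
    e = v ∨ e i₀ < v i₀ := by
  have hP (k : κ) (u : ι →₀ ℕ) (hu : e = lead k + u ∨ e i₀ < (lead k + u) i₀) :
      e = tail k + u ∨ e i₀ < (tail k + u) i₀ := by
    have hlt : (lead k + u) i₀ < (tail k + u) i₀ := by
      simpa [h.lead_apply] using h.tail_apply_pos k
    rcases hu with rfl | hu
    exacts [.inr hlt, .inr (hu.trans hlt)]
  obtain ⟨s, hs, hsw, hse⟩ := h.exists_isStandard (P := fun s => e = s ∨ e i₀ < s i₀) hP (.inl rfl)
  rwa [← h.eq_of_isStandard_of_weight_eq hs hv (hsw.trans hw)]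

theorem isMaxDegree_of_apply_eq_zero (h : IsAperySystem n i₀ lead tail) {e : ι →₀ ℕ}
    (he : IsStandard lead e) (he₀ : e i₀ = 0) : IsMaxDegree n e := by
  intro v hv
  rcases h.eq_or_apply_lt he hv with rfl | hlt
  · rfl
  · exact absurd (he₀ ▸ hlt) (Nat.not_lt_zero _)

theorem isMaxDegree_of_isStandard (h : IsAperySystem n i₀ lead tail)
    (hd : ∀ k, (lead k).degree ≤ (tail k).degree) {e : ι →₀ ℕ} (he : IsStandard lead e) :
    IsMaxDegree n e := by
  intro v hv
  obtain ⟨s, hs, hsw, hvs⟩ := h.exists_isStandard (P := fun s => v.degree ≤ s.degree)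
    (fun k u hku => hku.trans (by simpa using hd k)) le_rfl
  rwa [h.eq_of_isStandard_of_weight_eq hs he (hsw.trans hv)] at hvs

theorem isMaxDegree_single_add (h : IsAperySystem n i₀ lead tail)
    (hd : ∀ k, (lead k).degree ≤ (tail k).degree) {e : ι →₀ ℕ} (he : IsMaxDegree n e) :
    IsMaxDegree n (Finsupp.single i₀ 1 + e) := by
  obtain ⟨s, hs, hsw, -⟩ :=
    h.exists_isStandard (P := fun _ => True) (fun _ _ => id) (e := e) trivial
  refine (h.isMaxDegree_of_isStandard hd (hs.single_add h.lead_apply 1)).congr ?_ ?_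
  · rw [map_add, map_add, hsw]
  · simpa using he s hsw

theorem degree_lead_le_of_isMaxDegree_single_add (h : IsAperySystem n i₀ lead tail)
    (hX : ∀ e, IsMaxDegree n e → IsMaxDegree n (Finsupp.single i₀ 1 + e)) {k : κ}
    (hk : IsStandard lead ((tail k).erase i₀)) : (lead k).degree ≤ (tail k).degree := by
  have hmax (m : ℕ) : IsMaxDegree n (Finsupp.single i₀ m + (tail k).erase i₀) := by
    induction m with
    | zero =>
      rw [Finsupp.single_zero, zero_add]
      exact h.isMaxDegree_of_apply_eq_zero hk Finsupp.erase_same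
    | succ m ih =>
      rw [add_comm m, Finsupp.single_add, add_assoc]
      exact hX _ ih
  have htail := hmax (tail k i₀)
  rw [Finsupp.single_add_erase] at htail
  exact htail _ (h.weight_lead k)

end IsAperySystem

end AperySystem

section StandardBasis

theorem NegDegRevLexLT.asymm {σ : Equiv.Perm (Fin 4)} {a b : Fin 4 →₀ ℕ}
    (hab : NegDegRevLexLT σ a b) : ¬ NegDegRevLexLT σ b a := by
  rcases hab with hab | ⟨hab, i, hi, hi'⟩
  · rintro (hba | ⟨hba, -⟩)
    exacts [hab.asymm hba, hab.ne hba]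
  · rintro (hba | ⟨-, j, hj, hj'⟩)
    · exact hba.ne hab
    · rcases lt_trichotomy (σ i) (σ j) with hij | hij | hij
      · exact hi.ne (hj' i hij)
      · exact hi.asymm (σ.injective hij ▸ hj)
      · exact hj.ne (hi' j hij)

theorem negDegRevLexLT_of_degree_le {σ : Equiv.Perm (Fin 4)} {i₀ : Fin 4} (hσ : σ i₀ = 0)
    {a b : Fin 4 →₀ ℕ} (hd : b.degree ≤ a.degree) (hlt : b i₀ < a i₀) :
    NegDegRevLexLT σ a b :=
  hd.lt_or_eq.imp id fun hd =>
    ⟨hd.symm, i₀, hlt, fun _ hj => absurd (hσ ▸ hj) (Fin.not_lt_zero _)⟩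

variable {K : Type*} [Field K] {σ : Equiv.Perm (Fin 4)}

theorem IsLeadingExponent.unique {f : MvPolynomial (Fin 4) K} {a b : Fin 4 →₀ ℕ}
    (ha : IsLeadingExponent σ f a) (hb : IsLeadingExponent σ f b) : a = b :=
  by_contra fun hab => (ha.2 b hb.1 (Ne.symm hab)).asymm (hb.2 a ha.1 hab)

theorem IsLeadingExponent.neg {f : MvPolynomial (Fin 4) K} {a : Fin 4 →₀ ℕ}
    (ha : IsLeadingExponent σ f a) : IsLeadingExponent σ (-f) a := by
  rwa [IsLeadingExponent, support_neg]

theorem isLeadingExponent_monomial_sub_monomial {a b : Fin 4 →₀ ℕ} (h : NegDegRevLexLT σ b a) :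
    IsLeadingExponent σ (monomial a (1 : K) - monomial b 1) a := by
  classical
  have hba : b ≠ a := by
    rintro rfl
    exact h.asymm h
  refine ⟨by simp [mem_support_iff, coeff_monomial, hba], fun e he hea => ?_⟩
  rcases Finset.mem_union.1 (support_sub _ _ _ he) with he | he
  · exact absurd (Finset.mem_singleton.1 (support_monomial_subset he)) hea
  · rwa [Finset.mem_singleton.1 (support_monomial_subset he)]

theorem isMinimalStandardBasis_of_isLeadingExponent {r : ℕ} {g : Fin r → MvPolynomial (Fin 4) K}
    {I : Ideal (MvPolynomial (Fin 4) K)} {lead : Fin r → Fin 4 →₀ ℕ} (hmem : ∀ k, g k ∈ I)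
    (hlead : ∀ k, IsLeadingExponent σ (g k) (lead k))
    (hI : ∀ f ∈ I, ∀ a, IsLeadingExponent σ f a → ¬ IsStandard lead a)
    (hanti : Pairwise fun j k => ¬ lead j ≤ lead k) : IsMinimalStandardBasis σ g I where
  mem := hmem
  ne_zero k := ne_zero_iff.2 ⟨lead k, mem_support_iff.1 (hlead k).1⟩
  leadingIdeal_eq := by
    refine le_antisymm (Ideal.span_mono ?_) (Ideal.span_le.2 ?_)
    · rintro _ ⟨_, ⟨k, rfl⟩, a, ha, rfl⟩
      exact ⟨g k, hmem k, a, ha, rfl⟩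
    · rintro _ ⟨f, hf, a, ha, rfl⟩
      obtain ⟨k, hk⟩ := not_forall_not.1 (hI f hf a ha)
      exact Ideal.mem_of_dvd _ (monomial_dvd_monomial.2 ⟨.inr hk, dvd_rfl⟩)
        (Ideal.subset_span ⟨g k, ⟨k, rfl⟩, lead k, hlead k, rfl⟩)
  not_dvd j k hjk a b ha hb hdvd := by
    rw [ha.unique (hlead j), hb.unique (hlead k), monomial_dvd_monomial] at hdvd
    exact hanti hjk (hdvd.1.resolve_left one_ne_zero)

variable {n : Fin 4 → ℕ} {i₀ : Fin 4}

theorem IsAperySystem.not_isStandard_of_isLeadingExponent {κ : Type*}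
    {lead tail : κ → Fin 4 →₀ ℕ} (h : IsAperySystem n i₀ lead tail)
    (hd : ∀ k, (lead k).degree ≤ (tail k).degree) (hσ : σ i₀ = 0) {f : MvPolynomial (Fin 4) K}
    (hf : f ∈ curveIdeal K n) {a : Fin 4 →₀ ℕ} (ha : IsLeadingExponent σ f a) :
    ¬ IsStandard lead a := by
  intro hstd
  obtain ⟨e, he, hea, hw⟩ := exists_ne_mem_support_of_mem_curveIdeal hf ha.1
  exact (ha.2 e he hea).asymm <| negDegRevLexLT_of_degree_le hσ
    (h.isMaxDegree_of_isStandard hd hstd e hw) ((h.eq_or_apply_lt hstd hw).resolve_left hea)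

theorem IsAperySystem.isMinimalStandardBasis {r : ℕ} {lead tail : Fin r → Fin 4 →₀ ℕ}
    (h : IsAperySystem n i₀ lead tail) (hd : ∀ k, (lead k).degree ≤ (tail k).degree)
    (hanti : Pairwise fun j k => ¬ lead j ≤ lead k) (hσ : σ i₀ = 0)
    {g : Fin r → MvPolynomial (Fin 4) K}
    (hg : ∀ k, g k = monomial (lead k) 1 - monomial (tail k) 1 ∨
      g k = -(monomial (lead k) 1 - monomial (tail k) 1)) :
    IsMinimalStandardBasis σ g (curveIdeal K n) := by
  have hmem (k : Fin r) : monomial (lead k) (1 : K) - monomial (tail k) 1 ∈ curveIdeal K n :=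
    monomial_sub_monomial_mem_curveIdeal (h.weight_lead k)
  have hlead (k : Fin r) :
      IsLeadingExponent σ (monomial (lead k) (1 : K) - monomial (tail k) 1) (lead k) :=
    isLeadingExponent_monomial_sub_monomial <| negDegRevLexLT_of_degree_le hσ (hd k) <|
      (h.lead_apply k).trans_lt (h.tail_apply_pos k)
  refine isMinimalStandardBasis_of_isLeadingExponent (fun k => ?_) (fun k => ?_)
    (fun f hf a ha => h.not_isStandard_of_isLeadingExponent hd hσ hf ha) hanti
  · rcases hg k with hk | hk
    exacts [hk ▸ hmem k, hk ▸ neg_mem (hmem k)]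
  · rcases hg k with hk | hk
    exacts [hk ▸ hlead k, hk ▸ (hlead k).neg]

end StandardBasis

section CurveBinomials

/-- The exponent of the monomial `X₁ ^ a * X₂ ^ b * X₃ ^ c * X₄ ^ d`. -/
noncomputable def exponent (a b c d : ℕ) : Fin 4 →₀ ℕ :=
  Finsupp.equivFunOnFinite.symm ![a, b, c, d]

@[simp] theorem exponent_apply_zero (a b c d : ℕ) : exponent a b c d 0 = a := rfl

@[simp] theorem exponent_apply_one (a b c d : ℕ) : exponent a b c d 1 = b := rfl

@[simp] theorem exponent_apply_two (a b c d : ℕ) : exponent a b c d 2 = c := rfl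

@[simp] theorem exponent_apply_three (a b c d : ℕ) : exponent a b c d 3 = d := rfl

theorem exponent_le_iff {a b c d : ℕ} {e : Fin 4 →₀ ℕ} :
    exponent a b c d ≤ e ↔ a ≤ e 0 ∧ b ≤ e 1 ∧ c ≤ e 2 ∧ d ≤ e 3 := by
  simp [Finsupp.le_def, Fin.forall_fin_succ]

theorem erase_zero_exponent (a b c d : ℕ) :
    (exponent a b c d).erase 0 = exponent 0 b c d := by
  ext i
  fin_cases i <;> simp [Finsupp.erase]

theorem degree_exponent (a b c d : ℕ) : (exponent a b c d).degree = a + b + c + d := by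
  simp [Finsupp.degree_eq_sum, Fin.sum_univ_four]

theorem weight_exponent (n : Fin 4 → ℕ) (a b c d : ℕ) :
    Finsupp.weight n (exponent a b c d) = a * n 0 + b * n 1 + c * n 2 + d * n 3 := by
  rw [Finsupp.weight_apply, Finsupp.sum_fintype _ _ fun i => zero_smul ℕ (n i)]
  simp [Fin.sum_univ_four]

theorem monomial_exponent (R : Type*) [CommSemiring R] (a b c d : ℕ) :
    monomial (exponent a b c d) (1 : R) = X 0 ^ a * X 1 ^ b * X 2 ^ c * X 3 ^ d := by
  rw [monomial_eq, C_1, one_mul, Finsupp.prod_fintype _ _ fun i => pow_zero (X i)]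
  simp [Fin.prod_univ_four]

/-- The exponents of the terms of `curveBinomials` which are free of the first variable; in the
Cohen–Macaulay case they are the leading exponents. -/
noncomputable def leadExponent (α₂ α₃ α₄ : ℕ) : Fin 5 → Fin 4 →₀ ℕ :=
  ![exponent 0 0 1 (α₄ - 1), exponent 0 α₂ 0 0, exponent 0 0 α₃ 0, exponent 0 0 0 α₄,
    exponent 0 1 0 (α₄ - 1)]

/-- The exponents of the terms of `curveBinomials` which are divisible by the first variable. -/
noncomputable def tailExponent (α₂₁ α₁ α₂ α₃ : ℕ) : Fin 5 → Fin 4 →₀ ℕ :=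
  ![exponent α₁ 0 0 0, exponent α₂₁ 0 0 1, exponent (α₁ - α₂₁ - 1) 1 0 0,
    exponent 1 (α₂ - 1) (α₃ - 1) 0, exponent (α₂₁ + 1) 0 (α₃ - 1) 0]

variable {α₂₁ α₁ α₂ α₃ α₄ : ℕ}

theorem curveBinomials_eq_or_eq_neg (K : Type*) [Field K] (k : Fin 5) :
    curveBinomials K α₂₁ α₁ α₂ α₃ α₄ k =
        monomial (leadExponent α₂ α₃ α₄ k) 1 - monomial (tailExponent α₂₁ α₁ α₂ α₃ k) 1 ∨
      curveBinomials K α₂₁ α₁ α₂ α₃ α₄ k =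
        -(monomial (leadExponent α₂ α₃ α₄ k) 1 - monomial (tailExponent α₂₁ α₁ α₂ α₃ k) 1) := by
  fin_cases k
  · exact .inr (by simp [curveBinomials, leadExponent, tailExponent, monomial_exponent])
  · exact .inl (by simp [curveBinomials, leadExponent, tailExponent, monomial_exponent])
  · exact .inl (by simp [curveBinomials, leadExponent, tailExponent, monomial_exponent])
  · exact .inl (by simp [curveBinomials, leadExponent, tailExponent, monomial_exponent])
  · exact .inr (by simp [curveBinomials, leadExponent, tailExponent, monomial_exponent, mul_comm])

theorem pairwise_not_leadExponent_le (hα₂ : 1 < α₂) (hα₃ : 1 < α₃) (hα₄ : 1 < α₄) :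
    Pairwise fun j k => ¬ leadExponent α₂ α₃ α₄ j ≤ leadExponent α₂ α₃ α₄ k := by
  intro j k hjk
  fin_cases j <;> fin_cases k <;> first
  | exact absurd rfl hjk
  | simp only [leadExponent, Fin.zero_eta, Fin.mk_one, Fin.reduceFinMk, Matrix.cons_val,
      exponent_le_iff, exponent_apply_one, exponent_apply_two, exponent_apply_three]
    omega

theorem isStandard_leadExponent_iff {e : Fin 4 →₀ ℕ} :
    IsStandard (leadExponent α₂ α₃ α₄) e ↔
      e 1 < α₂ ∧ e 2 < α₃ ∧ e 3 < α₄ ∧ (α₄ - 1 ≤ e 3 → e 1 = 0 ∧ e 2 = 0) := by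
  simp only [IsStandard, Fin.forall_fin_succ, leadExponent, Matrix.cons_val_zero,
    Matrix.cons_val_succ, Matrix.cons_val_fin_one, forall_const, exponent_le_iff]
  omega

theorem encard_isStandard_leadExponent_le :
    {e | IsStandard (leadExponent α₂ α₃ α₄) e ∧ e 0 = 0}.encard ≤
      (α₂ * α₃ * (α₄ - 1) + 1 : ℕ) := by
  let T : Finset (ℕ × ℕ × ℕ) :=
    insert (0, 0, α₄ - 1) (Finset.range α₂ ×ˢ Finset.range α₃ ×ˢ Finset.range (α₄ - 1))
  have hT : T.card ≤ α₂ * α₃ * (α₄ - 1) + 1 := by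
    refine (Finset.card_insert_le _ _).trans_eq ?_
    simp only [Finset.card_product, Finset.card_range, mul_assoc]
  refine le_trans ?_ (Nat.cast_le.2 hT)
  rw [← Set.encard_coe_eq_coe_finsetCard]
  refine Set.encard_le_encard_of_injOn (f := fun e => (e 1, e 2, e 3)) ?_ ?_
  · rintro e ⟨he, -⟩
    rw [isStandard_leadExponent_iff] at he
    simp only [T, Finset.mem_coe, Finset.mem_insert, Finset.mem_product, Finset.mem_range,
      Prod.mk.injEq]
    omega
  · rintro e ⟨-, he⟩ v ⟨-, hv⟩ hev
    simp only [Prod.mk.injEq] at hev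
    ext i
    fin_cases i
    exacts [he.trans hv.symm, hev.1, hev.2.1, hev.2.2]

variable {n : Fin 4 → ℕ}

theorem weight_leadExponent (hα₂ : 1 ≤ α₂) (hα₃ : 1 ≤ α₃) (hα₄ : 1 ≤ α₄) (hα₁ : α₂₁ + 1 ≤ α₁)
    (hn₁ : n 0 = α₂ * α₃ * (α₄ - 1) + 1)
    (hn₂ : n 1 = α₂₁ * α₃ * α₄ + (α₁ - α₂₁ - 1) * (α₃ - 1) + α₃)
    (hn₃ : n 2 = α₁ * α₄ + (α₁ - α₂₁ - 1) * (α₂ - 1) * (α₄ - 1) - α₄ + 1)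
    (hn₄ : n 3 = α₁ * α₂ * (α₃ - 1) + α₂₁ * (α₂ - 1) + α₂) (k : Fin 5) :
    Finsupp.weight n (leadExponent α₂ α₃ α₄ k) =
      Finsupp.weight n (tailExponent α₂₁ α₁ α₂ α₃ k) := by
  obtain ⟨a₂, rfl⟩ := Nat.exists_eq_add_of_le' hα₂
  obtain ⟨a₃, rfl⟩ := Nat.exists_eq_add_of_le' hα₃
  obtain ⟨a₄, rfl⟩ := Nat.exists_eq_add_of_le' hα₄
  obtain ⟨p, rfl⟩ := Nat.exists_eq_add_of_le' hα₁
  have hp : p + (α₂₁ + 1) - α₂₁ - 1 = p := by omega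
  have hn₃' : n 2 = (p + α₂₁) * (a₄ + 1) + p * a₂ * a₄ + 1 := by
    rw [hn₃, hp, Nat.add_right_cancel_iff]
    refine Nat.sub_eq_of_eq_add ?_
    simp only [Nat.add_sub_cancel]
    ring
  fin_cases k <;>
  · simp only [leadExponent, tailExponent, Fin.zero_eta, Fin.mk_one, Fin.reduceFinMk,
      Matrix.cons_val, weight_exponent, hp, hn₁, hn₂, hn₃', hn₄, Nat.add_sub_cancel]
    ring

theorem isAperySystem_leadExponent_tailExponent (hα₂ : 1 ≤ α₂) (hα₃ : 1 ≤ α₃) (hα₄ : 1 ≤ α₄)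
    (hα₂₁ : 0 < α₂₁) (hα₁ : α₂₁ + 1 < α₁)
    (hn₁ : n 0 = α₂ * α₃ * (α₄ - 1) + 1)
    (hn₂ : n 1 = α₂₁ * α₃ * α₄ + (α₁ - α₂₁ - 1) * (α₃ - 1) + α₃)
    (hn₃ : n 2 = α₁ * α₄ + (α₁ - α₂₁ - 1) * (α₂ - 1) * (α₄ - 1) - α₄ + 1)
    (hn₄ : n 3 = α₁ * α₂ * (α₃ - 1) + α₂₁ * (α₂ - 1) + α₂) (hgcd : Finset.univ.gcd n = 1) :
    IsAperySystem n 0 (leadExponent α₂ α₃ α₄) (tailExponent α₂₁ α₁ α₂ α₃) where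
  pos := hn₁ ▸ Nat.succ_pos _
  gcd_eq_one := hgcd
  weight_lead := weight_leadExponent hα₂ hα₃ hα₄ hα₁.le hn₁ hn₂ hn₃ hn₄
  lead_apply k := by fin_cases k <;> rfl
  tail_apply_pos k := by
    fin_cases k <;>
    · simp only [tailExponent, Fin.zero_eta, Fin.mk_one, Fin.reduceFinMk, Matrix.cons_val,
        exponent_apply_zero]
      omega
  encard_le := hn₁ ▸ encard_isStandard_leadExponent_le

theorem degree_leadExponent_le_degree_tailExponent
    (h : IsAperySystem n 0 (leadExponent α₂ α₃ α₄) (tailExponent α₂₁ α₁ α₂ α₃))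
    (hmin : ∀ i, n 0 ≤ n i) (h₂ : α₂ ≤ α₂₁ + 1) (h₃ : α₂₁ + α₃ ≤ α₁) (h₄ : α₄ ≤ α₂ + α₃ - 1)
    (k : Fin 5) :
    (leadExponent α₂ α₃ α₄ k).degree ≤ (tailExponent α₂₁ α₁ α₂ α₃ k).degree := by
  have hzero : (leadExponent α₂ α₃ α₄ 0).degree ≤ α₁ := by
    have hle := degree_mul_le_weight hmin (leadExponent α₂ α₃ α₄ 0)
    rw [h.weight_lead 0] at hle
    refine Nat.le_of_mul_le_mul_right (hle.trans_eq ?_) h.pos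
    simp [tailExponent, weight_exponent]
  simp only [leadExponent, Matrix.cons_val, degree_exponent] at hzero
  fin_cases k <;>
  · simp only [leadExponent, tailExponent, Fin.zero_eta, Fin.mk_one, Fin.reduceFinMk,
      Matrix.cons_val, degree_exponent]
    omega

theorem le_of_isMaxDegree_single_add (hα₂ : 1 < α₂) (hα₃ : 1 < α₃) (hα₄ : 1 < α₄)
    (hα₁ : α₂₁ + 1 < α₁)
    (h : IsAperySystem n 0 (leadExponent α₂ α₃ α₄) (tailExponent α₂₁ α₁ α₂ α₃))
    (hX : ∀ e, IsMaxDegree n e → IsMaxDegree n (Finsupp.single 0 1 + e)) :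
    α₂ ≤ α₂₁ + 1 ∧ α₂₁ + α₃ ≤ α₁ ∧ α₄ ≤ α₂ + α₃ - 1 := by
  have hle {k : Fin 5} (hk : IsStandard (leadExponent α₂ α₃ α₄)
      ((tailExponent α₂₁ α₁ α₂ α₃ k).erase 0)) :
      (leadExponent α₂ α₃ α₄ k).degree ≤ (tailExponent α₂₁ α₁ α₂ α₃ k).degree :=
    h.degree_lead_le_of_isMaxDegree_single_add hX hk
  simp only [isStandard_leadExponent_iff] at hle
  have h₂ := @hle 1
  have h₃ := @hle 2
  have h₄ := @hle 3
  simp only [leadExponent, tailExponent, Matrix.cons_val, erase_zero_exponent, degree_exponent,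
    exponent_apply_one, exponent_apply_two, exponent_apply_three, and_self, and_true,
    implies_true] at h₂ h₃ h₄
  specialize h₂ (by omega)
  specialize h₃ (by omega)
  specialize h₄ (by omega)
  omega

end CurveBinomials

theorem theorem3p5 (K : Type*) [Field K] (α₂₁ α₁ α₂ α₃ α₄ : ℕ) (n : Fin 4 → ℕ)
    (hα₁ : 1 < α₁) (hα₂ : 1 < α₂) (hα₃ : 1 < α₃) (hα₄ : 1 < α₄)
    (hα₂₁ : 0 < α₂₁) (hα₂₁' : α₂₁ + 1 < α₁)
    (hn₁ : n 0 = α₂ * α₃ * (α₄ - 1) + 1)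
    (hn₂ : n 1 = α₂₁ * α₃ * α₄ + (α₁ - α₂₁ - 1) * (α₃ - 1) + α₃)
    (hn₃ : n 2 = α₁ * α₄ + (α₁ - α₂₁ - 1) * (α₂ - 1) * (α₄ - 1) - α₄ + 1)
    (hn₄ : n 3 = α₁ * α₂ * (α₃ - 1) + α₂₁ * (α₂ - 1) + α₂)
    (hgcd : Finset.univ.gcd n = 1)
    (hmin : ∀ i, n 0 ≤ n i) :
    (IsCohenMacaulay (MvPolynomial (Fin 4) K ⧸ tangentConeIdeal (curveIdeal K n)) ↔
      α₂ ≤ α₂₁ + 1 ∧ α₂₁ + α₃ ≤ α₁ ∧ α₄ ≤ α₂ + α₃ - 1) ∧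
    (IsCohenMacaulay (MvPolynomial (Fin 4) K ⧸ tangentConeIdeal (curveIdeal K n)) →
      ∀ σ : Equiv.Perm (Fin 4), σ 0 = 0 →
        IsMinimalStandardBasis σ (curveBinomials K α₂₁ α₁ α₂ α₃ α₄) (curveIdeal K n)) := by
  have h := isAperySystem_leadExponent_tailExponent hα₂.le hα₃.le hα₄.le hα₂₁ hα₂₁' hn₁ hn₂ hn₃
    hn₄ hgcd
  have hdeg := degree_leadExponent_le_degree_tailExponent h hmin
  have hnec := le_of_isMaxDegree_single_add hα₂ hα₃ hα₄ hα₂₁' h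
  rw [isCohenMacaulay_tangentCone_iff h.pos hmin]
  refine ⟨⟨hnec, fun ⟨h₂, h₃, h₄⟩ _ => h.isMaxDegree_single_add (hdeg h₂ h₃ h₄)⟩,
    fun hX σ hσ => ?_⟩
  obtain ⟨h₂, h₃, h₄⟩ := hnec hX
  exact h.isMinimalStandardBasis (hdeg h₂ h₃ h₄) (pairwise_not_leadExponent_le hα₂ hα₃ hα₄) hσ
    (curveBinomials_eq_or_eq_neg K)
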